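/- **Theorem 3.6.** For $m\ge 0$ let $\mathcal J_m=\begin{bmatrix}0&I_m\\-I_m&0\end{bmatrix}$, and write $\mathcal J=\mathcal J_n$. A matrix $\mathcal S\in\mathbb C^{2m\times 2m}$ is *symplectic* if $\mathcal S\mathcal J_m\mathcal S^H=\mathcal J_m$, a matrix $\mathcal K\in\mathbb C^{2m\times 2m}$ is *Hamiltonian* if $\mathcal K\mathcal J_m=(\mathcal K\mathcal J_m)^H$, and a pair $(\mathcal M,\mathcal L)$ of $2n\times 2n$ complex matrices is *symplectic* if $\mathcal M\mathcal J\mathcal M^H=\mathcal L\mathcal J\mathcal L^H$ and *regular* if $\det(\mathcal M-\lambda\mathcal L)\neq0$ for some $\lambda\in\mathbb C$. The index $\mathrm{ind}_\infty(\mathcal M,\mathcal L)$ of a regular pair is the index of nilpotency of $N$ in its Kronecker canonical form $P\mathcal MQ=J\oplus I$, $P\mathcal LQ=I\oplus N$ ($P,Q$ invertible, $N$ nilpotent); it is $0$ if $\mathcal L$ is invertible. Let $\mathcal S_1,\mathcal S_2\in\mathbb C^{2n\times 2n}$ be symplectic and let $$\mathbb S_{\mathcal S_1,\mathcal S_2}=\left\{\left(\begin{bmatrix}X_{12}&0\\X_{22}&I\end{bmatrix}\mathcal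 S_2,\ \begin{bmatrix}I&X_{11}\\0&X_{21}\end{bmatrix}\mathcal S_1\right)\ :\ X=\begin{bmatrix}X_{11}&X_{12}\\X_{21}&X_{22}\end{bmatrix}\in\mathbb C^{2n\times2n},\ X=X^H\right\}.$$ Let $(\mathcal M_1,\mathcal L_1)\in\mathbb S_{\mathcal S_1,\mathcal S_2}$ be a regular symplectic pair with $\mathrm{ind}_\infty(\mathcal M_1,\mathcal L_1)\le 1$. Let $\hat n\le n$, $\ell=n-\hat n$, $\operatorname{rank}\mathcal M_1=\operatorname{rank}\mathcal L_1=n+\hat n$, and let $U_1\in\mathbb C^{2n\times2\hat n}$, $U_0,U_\infty\in\mathbb C^{2n\times\ell}$, a symplectic $\widehat{\mathcal S}\in\mathbb C^{2\hat n\times2\hat n}$ and a Hamiltonian $\widehat{\mathcal H}\in\mathbb C^{2\hat n\times2\hat n}$ be any matrices such that, with $\mathbf U=[U_1\,|\,U_0,U_\infty]$, $$\mathbf U^H\mathcal J\mathbf U=\mathcal J_{\hat n}\oplus\mathcal J_\ell,\qquad \mathcal M_1U_0=0,\quad \mathcal L_1U_\infty=0,\quad \mathcal M_1U_1=\mathcal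 L_1U_1\widehat{\mathcal S},\qquad e^{\widehat{\mathcal H}}=\widehat{\mathcal S}.$$ Put $$\mathcal H=\mathbf U(\widehat{\mathcal H}\oplus0)(\mathcal J_{\hat n}\oplus\mathcal J_\ell)^H\mathbf U^H\mathcal J,$$ $$\Pi_0=\mathbf U(I_{2\hat n}\oplus I_\ell\oplus0)(\mathcal J_{\hat n}\oplus\mathcal J_\ell)^H\mathbf U^H\mathcal J,\qquad \Pi_\infty=\mathbf U(I_{2\hat n}\oplus0\oplus I_\ell)(\mathcal J_{\hat n}\oplus\mathcal J_\ell)^H\mathbf U^H\mathcal J.$$ For $t\in\mathbb R$ consider the system in the unknown pair $(\mathcal M(t),\mathcal L(t))$ $$\mathcal M(t)\Pi_0=\mathcal L(t)\Pi_\infty e^{\mathcal Ht},\qquad(\mathcal M(t),\mathcal L(t))\in\mathbb S_{\mathcal S_1,\mathcal S_2}.\tag{1}$$ Suppose $(\mathcal M(t),\mathcal L(t))$ is a solution of (1) at some $t\in\mathbb R$. Then 1. $(\mathcal M(t),\mathcal L(t))$ is regular; 2. $(\mathcal M(t),\mathcal L(t))$ is the unique solution of (1) at $t$; 3. $$\mathcal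 M(t)U_0=0,\qquad\mathcal L(t)U_\infty=0,\qquad\mathcal M(t)U_1=\mathcal L(t)U_1e^{\widehat{\mathcal H}t}.\tag{2}$$ Conversely, for every $t\in\mathbb R$, if $(\mathcal M(t),\mathcal L(t))\in\mathbb S_{\mathcal S_1,\mathcal S_2}$ satisfies (2), then it is a solution of (1) at $t$. -/

import Mathlib

open Matrix

noncomputable section

namespace SymplecticFlow

/-- The matrix `J_m = [0, I; -I, 0]` of size `2m`; rows and columns are indexed by two copies
of `Fin m`. -/
def symJ (m : ℕ) : Matrix (Fin m ⊕ Fin m) (Fin m ⊕ Fin m) ℂ :=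
  fromBlocks 0 1 (-1) 0

/-- `S` is symplectic: `S J Sᴴ = J`. -/
def IsSymplectic {m : ℕ} (S : Matrix (Fin m ⊕ Fin m) (Fin m ⊕ Fin m) ℂ) : Prop :=
  S * symJ m * Sᴴ = symJ m

/-- `H` is Hamiltonian: `H J = (H J)ᴴ`. -/
def IsHamiltonian {m : ℕ} (H : Matrix (Fin m ⊕ Fin m) (Fin m ⊕ Fin m) ℂ) : Prop :=
  H * symJ m = (H * symJ m)ᴴ

/-- `(M, L)` is a symplectic pair: `M J Mᴴ = L J Lᴴ`. -/
def IsSymplecticPair {m : ℕ} (M L : Matrix (Fin m ⊕ Fin m) (Fin m ⊕ Fin m) ℂ) : Prop :=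
  M * symJ m * Mᴴ = L * symJ m * Lᴴ

/-- The pair `(A, B)` is regular: `det (A - z B) ≠ 0` for some complex `z`. -/
def IsRegularPair {ι : Type*} [Fintype ι] [DecidableEq ι] (A B : Matrix ι ι ℂ) : Prop :=
  ∃ z : ℂ, (A - z • B).det ≠ 0

/-- The pair `(A, B)` has index `ν` at infinity: there are invertible `P`, `Q` with
`P A Q = J ⊕ I` and `P B Q = I ⊕ N`, where `N` is nilpotent with index of nilpotency `ν`, the
least `k` with `N ^ k = 0`. Bringing `J` and `N` to Jordan form changes `P` and `Q` but not `ν`,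
so Jordan form is not asked for. If `B` is invertible then `N` is the empty matrix and `ν = 0`. -/
def HasIndexAtInfinity {ι : Type*} [Fintype ι] [DecidableEq ι] (A B : Matrix ι ι ℂ)
    (ν : ℕ) : Prop :=
  ∃ (p q : ℕ) (e : Fin p ⊕ Fin q ≃ ι) (P Q : Matrix ι ι ℂ)
    (J : Matrix (Fin p) (Fin p) ℂ) (N : Matrix (Fin q) (Fin q) ℂ),
    IsUnit P ∧ IsUnit Q ∧
    P * A * Q = reindex e e (fromBlocks J 0 0 1) ∧
    P * B * Q = reindex e e (fromBlocks 1 0 0 N) ∧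
    IsNilpotent N ∧ nilpotencyClass N = ν

/-- The class of pairs `([X₁₂, 0; X₂₂, I] S₂, [I, X₁₁; 0, X₂₁] S₁)`, where
`X = [X₁₁, X₁₂; X₂₁, X₂₂]` is Hermitian. -/
def pairClass {n : ℕ} (S₁ S₂ : Matrix (Fin n ⊕ Fin n) (Fin n ⊕ Fin n) ℂ) :
    Set (Matrix (Fin n ⊕ Fin n) (Fin n ⊕ Fin n) ℂ ×
      Matrix (Fin n ⊕ Fin n) (Fin n ⊕ Fin n) ℂ) :=
  {p | ∃ X₁₁ X₁₂ X₂₁ X₂₂ : Matrix (Fin n) (Fin n) ℂ,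
    (fromBlocks X₁₁ X₁₂ X₂₁ X₂₂).IsHermitian ∧
    p.1 = fromBlocks X₁₂ 0 X₂₂ 1 * S₂ ∧
    p.2 = fromBlocks 1 X₁₁ 0 X₂₁ * S₁}

section Frame

variable {n k l : ℕ}

/-- The matrix `U = [U₁ | U₀, U∞]`. -/
def frame (U₁ : Matrix (Fin n ⊕ Fin n) (Fin k ⊕ Fin k) ℂ)
    (U₀ Uinf : Matrix (Fin n ⊕ Fin n) (Fin l) ℂ) :
    Matrix (Fin n ⊕ Fin n) ((Fin k ⊕ Fin k) ⊕ (Fin l ⊕ Fin l)) ℂ :=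
  fromCols U₁ (fromCols U₀ Uinf)

/-- The direct sum `J_k ⊕ J_l`. -/
def symJSum (k l : ℕ) :
    Matrix ((Fin k ⊕ Fin k) ⊕ (Fin l ⊕ Fin l)) ((Fin k ⊕ Fin k) ⊕ (Fin l ⊕ Fin l)) ℂ :=
  fromBlocks (symJ k) 0 0 (symJ l)

/-- The matrix `U D (J_k ⊕ J_l)ᴴ Uᴴ J`, where `U = [U₁ | U₀, U∞]`. -/
def frameConj (U₁ : Matrix (Fin n ⊕ Fin n) (Fin k ⊕ Fin k) ℂ)
    (U₀ Uinf : Matrix (Fin n ⊕ Fin n) (Fin l) ℂ)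
    (D : Matrix ((Fin k ⊕ Fin k) ⊕ (Fin l ⊕ Fin l)) ((Fin k ⊕ Fin k) ⊕ (Fin l ⊕ Fin l)) ℂ) :
    Matrix (Fin n ⊕ Fin n) (Fin n ⊕ Fin n) ℂ :=
  frame U₁ U₀ Uinf * D * (symJSum k l)ᴴ * (frame U₁ U₀ Uinf)ᴴ * symJ n

/-- `H = U (Ĥ ⊕ 0) (J_k ⊕ J_l)ᴴ Uᴴ J`. -/
def hamH (U₁ : Matrix (Fin n ⊕ Fin n) (Fin k ⊕ Fin k) ℂ)
    (U₀ Uinf : Matrix (Fin n ⊕ Fin n) (Fin l) ℂ)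
    (Hhat : Matrix (Fin k ⊕ Fin k) (Fin k ⊕ Fin k) ℂ) :
    Matrix (Fin n ⊕ Fin n) (Fin n ⊕ Fin n) ℂ :=
  frameConj U₁ U₀ Uinf (fromBlocks Hhat 0 0 0)

/-- `Π₀ = U (I ⊕ I ⊕ 0) (J_k ⊕ J_l)ᴴ Uᴴ J`. -/
def projZero (U₁ : Matrix (Fin n ⊕ Fin n) (Fin k ⊕ Fin k) ℂ)
    (U₀ Uinf : Matrix (Fin n ⊕ Fin n) (Fin l) ℂ) :
    Matrix (Fin n ⊕ Fin n) (Fin n ⊕ Fin n) ℂ :=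
  frameConj U₁ U₀ Uinf (fromBlocks 1 0 0 (fromBlocks 1 0 0 0))

/-- `Π∞ = U (I ⊕ 0 ⊕ I) (J_k ⊕ J_l)ᴴ Uᴴ J`. -/
def projInf (U₁ : Matrix (Fin n ⊕ Fin n) (Fin k ⊕ Fin k) ℂ)
    (U₀ Uinf : Matrix (Fin n ⊕ Fin n) (Fin l) ℂ) :
    Matrix (Fin n ⊕ Fin n) (Fin n ⊕ Fin n) ℂ :=
  frameConj U₁ U₀ Uinf (fromBlocks 1 0 0 (fromBlocks 0 0 0 1))

/-- `U₁`, `U₀`, `U∞`, `Ŝ`, `Ĥ` are the matrices `U(M, L)`, `Ŝ(M, L)`, `Ĥ(M, L)` attached to the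
pair `(M, L)` (they are not unique; any admissible choice is allowed). -/
structure IsEigenData (M L : Matrix (Fin n ⊕ Fin n) (Fin n ⊕ Fin n) ℂ)
    (U₁ : Matrix (Fin n ⊕ Fin n) (Fin k ⊕ Fin k) ℂ)
    (U₀ Uinf : Matrix (Fin n ⊕ Fin n) (Fin l) ℂ)
    (Shat Hhat : Matrix (Fin k ⊕ Fin k) (Fin k ⊕ Fin k) ℂ) : Prop where
  size : k + l = n
  rank_left : M.rank = n + k
  rank_right : L.rank = n + k
  frame_symJ : (frame U₁ U₀ Uinf)ᴴ * symJ n * frame U₁ U₀ Uinf = symJSum k l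
  symplectic : IsSymplectic Shat
  mul_zero_space : M * U₀ = 0
  mul_inf_space : L * Uinf = 0
  mul_finite_space : M * U₁ = L * U₁ * Shat
  hamiltonian : IsHamiltonian Hhat
  exp_eq : NormedSpace.exp Hhat = Shat

/-- `(M, L)` solves the system at the real number `t`:
`M Π₀ = L Π∞ e^{H t}` and `(M, L)` lies in the class of `S₁`, `S₂`. -/
def IsSolutionAt (S₁ S₂ : Matrix (Fin n ⊕ Fin n) (Fin n ⊕ Fin n) ℂ)
    (U₁ : Matrix (Fin n ⊕ Fin n) (Fin k ⊕ Fin k) ℂ)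
    (U₀ Uinf : Matrix (Fin n ⊕ Fin n) (Fin l) ℂ)
    (Hhat : Matrix (Fin k ⊕ Fin k) (Fin k ⊕ Fin k) ℂ) (t : ℝ)
    (M L : Matrix (Fin n ⊕ Fin n) (Fin n ⊕ Fin n) ℂ) : Prop :=
  M * projZero U₁ U₀ Uinf =
      L * projInf U₁ U₀ Uinf * NormedSpace.exp (t • hamH U₁ U₀ Uinf Hhat) ∧
    (M, L) ∈ pairClass S₁ S₂

/-- The eigenvector-preserving relations at `t`:
`M U₀ = 0`, `L U∞ = 0`, `M U₁ = L U₁ e^{Ĥ t}`. -/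
def PreservesEigenvectorsAt (U₁ : Matrix (Fin n ⊕ Fin n) (Fin k ⊕ Fin k) ℂ)
    (U₀ Uinf : Matrix (Fin n ⊕ Fin n) (Fin l) ℂ)
    (Hhat : Matrix (Fin k ⊕ Fin k) (Fin k ⊕ Fin k) ℂ) (t : ℝ)
    (M L : Matrix (Fin n ⊕ Fin n) (Fin n ⊕ Fin n) ℂ) : Prop :=
  M * U₀ = 0 ∧ L * Uinf = 0 ∧ M * U₁ = L * U₁ * NormedSpace.exp (t • Hhat)

end Frame

end SymplecticFlow

end

/-!
The frame `U = [U₁ | U₀, U∞]` satisfies `Uᴴ J U = J_k ⊕ J_l` and is square, so it is invertible with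
inverse `(J_k ⊕ J_l)ᴴ Uᴴ J`, and `frameConj D = U D U⁻¹` (`exists_frame_inverse`). Hence
`exp (t H) = U (exp (t Ĥ) ⊕ 1) U⁻¹`, and multiplying the system on the right by `U` turns it into
`M [U₁, U₀, 0] = L [U₁ exp (t Ĥ), 0, U∞]`, which is the list of eigenvector relations
(`system_iff_preservesEigenvectorsAt`). This gives the third claim and the converse.

Uniqueness: with `P = S₂ Π₀` and `Q = S₁ Π∞ exp (t H)`, the system is the linear equation
`X T = R` in the block matrix `X`, where `T = [Q_bot; -P_top]` and `R = [-Q_top; P_bot]`.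
If it has a solution `X`, then `P` and `Q` both have the form `C T`; since `Π₀` and
`Π∞ exp (t H)` have no common kernel, `T` is invertible and `X = R T⁻¹`
(`pairClass_unique`).

Regularity: choose `z ≠ 0` outside the spectrum of `E = exp (t Ĥ)`. From
`(M - z L) U = [L U₁ (E - z), -z L U₀, M U∞]` both `M` and `L` have the form `(M - z L) C`.
A pair in the class has `[M, L]` right invertible (`exists_mul_add_mul_eq_one`), so `M - z L` is
right invertible as well.
-/

namespace SymplecticFlow

/-! ### Symplectic matrices -/

lemma symJ_mul_conjTranspose (m : ℕ) : symJ m * (symJ m)ᴴ = 1 := by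
  simp [symJ, fromBlocks_conjTranspose, fromBlocks_multiply]

lemma symJ_conjTranspose_mul (m : ℕ) : (symJ m)ᴴ * symJ m = 1 :=
  mul_eq_one_comm.mp (symJ_mul_conjTranspose m)

lemma IsSymplectic.exists_inverse {m : ℕ} {S : Matrix (Fin m ⊕ Fin m) (Fin m ⊕ Fin m) ℂ}
    (hS : IsSymplectic S) : ∃ S' : Matrix (Fin m ⊕ Fin m) (Fin m ⊕ Fin m) ℂ,
      S * S' = 1 ∧ S' * S = 1 := by
  have h : S * (symJ m * Sᴴ * (symJ m)ᴴ) = 1 := by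
    rw [← Matrix.mul_assoc, ← Matrix.mul_assoc, hS, symJ_mul_conjTranspose]
  exact ⟨_, h, mul_eq_one_comm.mp h⟩

lemma symJSum_conjTranspose_mul (k l : ℕ) : (symJSum k l)ᴴ * symJSum k l = 1 := by
  simp [symJSum, fromBlocks_conjTranspose, fromBlocks_multiply, symJ_conjTranspose_mul]

/-! ### Exponentials of intertwined matrices -/

/-- If `X` intertwines `A` and `B`, then it intertwines their exponentials. -/
lemma exp_mul_of_intertwine {ι κ : Type*} [Fintype ι] [DecidableEq ι] [Fintype κ] [DecidableEq κ]
    {A : Matrix ι ι ℂ} {B : Matrix κ κ ℂ} {X : Matrix ι κ ℂ} (h : A * X = X * B) :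
    NormedSpace.exp A * X = X * NormedSpace.exp B := by
  -- The exponential does not depend on the norm; one is fixed to sum the exponential series.
  let : NormedRing (Matrix ι ι ℂ) := Matrix.linftyOpNormedRing
  let : NormedAlgebra ℂ (Matrix ι ι ℂ) := Matrix.linftyOpNormedAlgebra
  let : NormedRing (Matrix κ κ ℂ) := Matrix.linftyOpNormedRing
  let : NormedAlgebra ℂ (Matrix κ κ ℂ) := Matrix.linftyOpNormedAlgebra
  have hpow : ∀ j : ℕ, A ^ j * X = X * B ^ j := by
    intro j
    induction j with
    | zero => simp
    | succ j ih => rw [pow_succ', Matrix.mul_assoc, ih, ← Matrix.mul_assoc, h, Matrix.mul_assoc,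
        ← pow_succ']
  have hA : HasSum (fun j : ℕ => ((j.factorial : ℂ)⁻¹ • A ^ j) * X) (NormedSpace.exp A * X) :=
    (NormedSpace.exp_series_hasSum_exp' (𝕂 := ℂ) A).map (addMonoidHomMulRight X)
      (continuous_id.matrix_mul continuous_const)
  have hB : HasSum (fun j : ℕ => X * ((j.factorial : ℂ)⁻¹ • B ^ j)) (X * NormedSpace.exp B) :=
    (NormedSpace.exp_series_hasSum_exp' (𝕂 := ℂ) B).map (addMonoidHomMulLeft X)
      (continuous_const.matrix_mul continuous_id)
  refine hA.unique ?_
  convert hB using 2 with j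
  rw [Matrix.smul_mul, Matrix.mul_smul, hpow]

/-! ### The frame and conjugation by it -/

section Frame

variable {n k l : ℕ} {U₁ : Matrix (Fin n ⊕ Fin n) (Fin k ⊕ Fin k) ℂ}
  {U₀ Uinf : Matrix (Fin n ⊕ Fin n) (Fin l) ℂ}

/-- The square matrix `U` is invertible, and `frameConj` is conjugation by it. -/
lemma exists_frame_inverse (hsize : k + l = n)
    (hU : (frame U₁ U₀ Uinf)ᴴ * symJ n * frame U₁ U₀ Uinf = symJSum k l) :
    ∃ V : Matrix ((Fin k ⊕ Fin k) ⊕ (Fin l ⊕ Fin l)) (Fin n ⊕ Fin n) ℂ,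
      frame U₁ U₀ Uinf * V = 1 ∧ V * frame U₁ U₀ Uinf = 1 ∧
      ∀ D, frameConj U₁ U₀ Uinf D = frame U₁ U₀ Uinf * D * V := by
  have h : ((symJSum k l)ᴴ * ((frame U₁ U₀ Uinf)ᴴ * symJ n)) * frame U₁ U₀ Uinf = 1 := by
    rw [Matrix.mul_assoc, hU, symJSum_conjTranspose_mul]
  refine ⟨_, (Matrix.mul_eq_one_comm_of_card_eq _ _ _ ?_).mp h, h, fun D => ?_⟩
  · simp only [Fintype.card_sum, Fintype.card_fin]
    omega
  · simp only [frameConj, Matrix.mul_assoc]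

lemma mul_frame (M : Matrix (Fin n ⊕ Fin n) (Fin n ⊕ Fin n) ℂ) :
    M * frame U₁ U₀ Uinf = fromCols (M * U₁) (fromCols (M * U₀) (M * Uinf)) := by
  simp only [frame, mul_fromCols]

/-- The direct sum `D ⊕ b ⊕ c`, partitioned like the columns of the frame `[U₁ | U₀, U∞]`. -/
def blockSum (k l : ℕ) (D : Matrix (Fin k ⊕ Fin k) (Fin k ⊕ Fin k) ℂ)
    (b c : Matrix (Fin l) (Fin l) ℂ) :
    Matrix ((Fin k ⊕ Fin k) ⊕ (Fin l ⊕ Fin l)) ((Fin k ⊕ Fin k) ⊕ (Fin l ⊕ Fin l)) ℂ :=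
  fromBlocks D 0 0 (fromBlocks b 0 0 c)

lemma blockSum_mul (D D' : Matrix (Fin k ⊕ Fin k) (Fin k ⊕ Fin k) ℂ)
    (b c b' c' : Matrix (Fin l) (Fin l) ℂ) :
    blockSum k l D b c * blockSum k l D' b' c' = blockSum k l (D * D') (b * b') (c * c') := by
  simp [blockSum, fromBlocks_multiply]

lemma blockSum_add (D D' : Matrix (Fin k ⊕ Fin k) (Fin k ⊕ Fin k) ℂ)
    (b c b' c' : Matrix (Fin l) (Fin l) ℂ) :
    blockSum k l D b c + blockSum k l D' b' c' = blockSum k l (D + D') (b + b') (c + c') := by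
  simp [blockSum, fromBlocks_add]

lemma blockSum_one : blockSum k l 1 1 1 = 1 := by
  simp [blockSum]

lemma fromCols_mul_blockSum (A : Matrix (Fin n ⊕ Fin n) (Fin k ⊕ Fin k) ℂ)
    (B C : Matrix (Fin n ⊕ Fin n) (Fin l) ℂ) (D : Matrix (Fin k ⊕ Fin k) (Fin k ⊕ Fin k) ℂ)
    (b c : Matrix (Fin l) (Fin l) ℂ) :
    fromCols A (fromCols B C) * blockSum k l D b c =
      fromCols (A * D) (fromCols (B * b) (C * c)) := by
  simp [blockSum, fromCols_mul_fromBlocks]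

lemma exp_hamH_mul_frame (hsize : k + l = n)
    (hU : (frame U₁ U₀ Uinf)ᴴ * symJ n * frame U₁ U₀ Uinf = symJSum k l)
    (Hhat : Matrix (Fin k ⊕ Fin k) (Fin k ⊕ Fin k) ℂ) (t : ℝ) :
    NormedSpace.exp (t • hamH U₁ U₀ Uinf Hhat) * frame U₁ U₀ Uinf =
      frame U₁ U₀ Uinf *
        blockSum k l (NormedSpace.exp (t • Hhat)) 1 1 := by
  obtain ⟨V, -, hVU, hconj⟩ := exists_frame_inverse hsize hU
  have h : hamH U₁ U₀ Uinf Hhat * frame U₁ U₀ Uinf =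
      frame U₁ U₀ Uinf * blockSum k l Hhat 0 0 := by
    rw [hamH, hconj, Matrix.mul_assoc, hVU, Matrix.mul_one, blockSum, fromBlocks_zero]
  rw [mul_frame, frame, fromCols_mul_blockSum, fromCols_ext_iff, fromCols_ext_iff] at h
  obtain ⟨h₁, h₀, hinf⟩ := h
  rw [mul_frame, frame, fromCols_mul_blockSum, fromCols_ext_iff, fromCols_ext_iff]
  refine ⟨exp_mul_of_intertwine ?_, ?_, ?_⟩
  · rw [Matrix.smul_mul, Matrix.mul_smul, h₁]
  · rw [← NormedSpace.exp_zero]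
    exact exp_mul_of_intertwine (by rw [Matrix.smul_mul, h₀, Matrix.mul_zero, smul_zero])
  · rw [← NormedSpace.exp_zero]
    exact exp_mul_of_intertwine (by rw [Matrix.smul_mul, hinf, Matrix.mul_zero, smul_zero])

lemma projZero_mul_frame (hsize : k + l = n)
    (hU : (frame U₁ U₀ Uinf)ᴴ * symJ n * frame U₁ U₀ Uinf = symJSum k l) :
    projZero U₁ U₀ Uinf * frame U₁ U₀ Uinf =
      frame U₁ U₀ Uinf * blockSum k l 1 1 0 := by
  obtain ⟨V, -, hVU, hconj⟩ := exists_frame_inverse hsize hU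
  rw [projZero, hconj, Matrix.mul_assoc, hVU, Matrix.mul_one, blockSum]

lemma projInf_mul_exp_mul_frame (hsize : k + l = n)
    (hU : (frame U₁ U₀ Uinf)ᴴ * symJ n * frame U₁ U₀ Uinf = symJSum k l)
    (Hhat : Matrix (Fin k ⊕ Fin k) (Fin k ⊕ Fin k) ℂ) (t : ℝ) :
    projInf U₁ U₀ Uinf * NormedSpace.exp (t • hamH U₁ U₀ Uinf Hhat) * frame U₁ U₀ Uinf =
      frame U₁ U₀ Uinf *
        blockSum k l (NormedSpace.exp (t • Hhat)) 0 1 := by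
  obtain ⟨V, -, hVU, hconj⟩ := exists_frame_inverse hsize hU
  rw [Matrix.mul_assoc, exp_hamH_mul_frame hsize hU, projInf, hconj, Matrix.mul_assoc,
    ← Matrix.mul_assoc V, hVU, Matrix.one_mul, Matrix.mul_assoc, ← blockSum, blockSum_mul]
  simp only [Matrix.one_mul, Matrix.mul_one]

/-- Multiplication by the invertible frame identifies the system with the eigenvector relations. -/
lemma system_iff_preservesEigenvectorsAt (hsize : k + l = n)
    (hU : (frame U₁ U₀ Uinf)ᴴ * symJ n * frame U₁ U₀ Uinf = symJSum k l)
    (Hhat : Matrix (Fin k ⊕ Fin k) (Fin k ⊕ Fin k) ℂ) (t : ℝ)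
    (M L : Matrix (Fin n ⊕ Fin n) (Fin n ⊕ Fin n) ℂ) :
    M * projZero U₁ U₀ Uinf =
        L * projInf U₁ U₀ Uinf * NormedSpace.exp (t • hamH U₁ U₀ Uinf Hhat) ↔
      PreservesEigenvectorsAt U₁ U₀ Uinf Hhat t M L := by
  obtain ⟨V, hUV, -⟩ := exists_frame_inverse hsize hU
  have hcancel : ∀ A B : Matrix (Fin n ⊕ Fin n) (Fin n ⊕ Fin n) ℂ,
      A = B ↔ A * frame U₁ U₀ Uinf = B * frame U₁ U₀ Uinf := fun A B =>
    ⟨fun h => by rw [h], fun h => by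
      rw [← Matrix.mul_one A, ← Matrix.mul_one B, ← hUV, ← Matrix.mul_assoc, h, Matrix.mul_assoc]⟩
  rw [hcancel, Matrix.mul_assoc M, projZero_mul_frame hsize hU, Matrix.mul_assoc L,
    Matrix.mul_assoc L, projInf_mul_exp_mul_frame hsize hU, ← Matrix.mul_assoc, ← Matrix.mul_assoc,
    mul_frame, mul_frame, fromCols_mul_blockSum, fromCols_mul_blockSum, fromCols_ext_iff,
    fromCols_ext_iff]
  simp only [Matrix.mul_one, Matrix.mul_zero, PreservesEigenvectorsAt]
  exact ⟨fun h => ⟨h.2.1, h.2.2.symm, h.1⟩, fun h => ⟨h.2.2, h.1, h.2.1.symm⟩⟩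

/-- `Π₀` and `Π∞ exp (t H)` have no common kernel, since `Π₀` detects the components along `U₁` and
`U₀` and `Π∞ exp (t H)` the one along `U∞`. The left inverse is the form used for uniqueness. -/
lemma exists_mul_projZero_add_mul_projInf_eq_one (hsize : k + l = n)
    (hU : (frame U₁ U₀ Uinf)ᴴ * symJ n * frame U₁ U₀ Uinf = symJSum k l)
    (Hhat : Matrix (Fin k ⊕ Fin k) (Fin k ⊕ Fin k) ℂ) (t : ℝ) :
    ∃ B C : Matrix (Fin n ⊕ Fin n) (Fin n ⊕ Fin n) ℂ,
      B * projZero U₁ U₀ Uinf +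
        C * (projInf U₁ U₀ Uinf * NormedSpace.exp (t • hamH U₁ U₀ Uinf Hhat)) = 1 := by
  obtain ⟨V, hUV, hVU, -⟩ := exists_frame_inverse hsize hU
  set F := frame U₁ U₀ Uinf with hF
  have hD (D D' : Matrix ((Fin k ⊕ Fin k) ⊕ (Fin l ⊕ Fin l))
      ((Fin k ⊕ Fin k) ⊕ (Fin l ⊕ Fin l)) ℂ) : F * D * V * (F * D') = F * (D * D') := by
    simp only [Matrix.mul_assoc]
    rw [← Matrix.mul_assoc V, hVU, Matrix.one_mul]
  refine ⟨F * blockSum k l 1 1 0 * V, F * blockSum k l 0 0 1 * V, ?_⟩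
  rw [← Matrix.mul_one (_ + _), ← hUV, ← Matrix.mul_assoc, Matrix.add_mul, Matrix.mul_assoc,
    projZero_mul_frame hsize hU, Matrix.mul_assoc _ _ F, projInf_mul_exp_mul_frame hsize hU, ← hF,
    hD, hD, ← Matrix.mul_add, blockSum_mul, blockSum_mul, blockSum_add]
  simp [blockSum_one]

end Frame

/-! ### Pairs in the class -/

section PairClass

variable {n : ℕ} {S₁ S₂ : Matrix (Fin n ⊕ Fin n) (Fin n ⊕ Fin n) ℂ}

/-- The identity columns in the two factors show that for a pair in the class, the block row
`[M, L]` is right invertible. -/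
lemma exists_mul_add_mul_eq_one (hS₁ : IsSymplectic S₁) (hS₂ : IsSymplectic S₂)
    {M L : Matrix (Fin n ⊕ Fin n) (Fin n ⊕ Fin n) ℂ} (h : (M, L) ∈ pairClass S₁ S₂) :
    ∃ A B : Matrix (Fin n ⊕ Fin n) (Fin n ⊕ Fin n) ℂ, M * A + L * B = 1 := by
  obtain ⟨X₁₁, X₁₂, X₂₁, X₂₂, -, hM, hL⟩ := h
  obtain ⟨S₁', h₁, -⟩ := hS₁.exists_inverse
  obtain ⟨S₂', h₂, -⟩ := hS₂.exists_inverse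
  refine ⟨S₂' * fromBlocks 0 0 0 1, S₁' * fromBlocks 1 0 0 0, ?_⟩
  simp only at hM hL
  rw [hM, hL, Matrix.mul_assoc, ← Matrix.mul_assoc S₂, h₂, Matrix.mul_assoc,
    ← Matrix.mul_assoc S₁, h₁]
  simp [fromBlocks_multiply, fromBlocks_add]

/-- The relation between the two members of a pair in the class is linear in the parameter `X`. -/
lemma fromBlocks_mul_eq_iff (X₁₁ X₁₂ X₂₁ X₂₂ P₁₁ P₁₂ P₂₁ P₂₂ Q₁₁ Q₁₂ Q₂₁ Q₂₂ :
    Matrix (Fin n) (Fin n) ℂ) :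
    fromBlocks X₁₂ 0 X₂₂ 1 * fromBlocks P₁₁ P₁₂ P₂₁ P₂₂ =
        fromBlocks 1 X₁₁ 0 X₂₁ * fromBlocks Q₁₁ Q₁₂ Q₂₁ Q₂₂ ↔
      fromBlocks X₁₁ X₁₂ X₂₁ X₂₂ * fromBlocks Q₂₁ Q₂₂ (-P₁₁) (-P₁₂) =
        fromBlocks (-Q₁₁) (-Q₁₂) P₂₁ P₂₂ := by
  simp only [fromBlocks_multiply, fromBlocks_inj, Matrix.zero_mul, Matrix.one_mul, Matrix.mul_neg,
    add_zero, zero_add]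
  constructor <;> rintro ⟨h₁, h₂, h₃, h₄⟩ <;> refine ⟨?_, ?_, ?_, ?_⟩ <;> grind

/-- A pair in the class is determined by a relation `M A = L B` in which `A` and `B` have no
common kernel: one solution of that relation already forces the coefficient matrix `T` of the
linear equation for `X` to be invertible. -/
lemma pairClass_unique (hS₁ : IsSymplectic S₁) (hS₂ : IsSymplectic S₂)
    {A B C D M L M' L' : Matrix (Fin n ⊕ Fin n) (Fin n ⊕ Fin n) ℂ} (hAB : C * A + D * B = 1)
    (h : (M, L) ∈ pairClass S₁ S₂) (h' : (M', L') ∈ pairClass S₁ S₂)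
    (he : M * A = L * B) (he' : M' * A = L' * B) : M' = M ∧ L' = L := by
  obtain ⟨X₁₁, X₁₂, X₂₁, X₂₂, -, hM, hL⟩ := h
  obtain ⟨Y₁₁, Y₁₂, Y₂₁, Y₂₂, -, hM', hL'⟩ := h'
  obtain ⟨S₁', -, h₁⟩ := hS₁.exists_inverse
  obtain ⟨S₂', -, h₂⟩ := hS₂.exists_inverse
  simp only at hM hL hM' hL'
  rw [hM, hL, Matrix.mul_assoc, Matrix.mul_assoc] at he
  rw [hM', hL', Matrix.mul_assoc, Matrix.mul_assoc] at he'
  have hA : S₂' * (S₂ * A) = A := by rw [← Matrix.mul_assoc, h₂, Matrix.one_mul]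
  have hB : S₁' * (S₁ * B) = B := by rw [← Matrix.mul_assoc, h₁, Matrix.one_mul]
  obtain ⟨P₁₁, P₁₂, P₂₁, P₂₂, hP⟩ : ∃ P₁₁ P₁₂ P₂₁ P₂₂ : Matrix (Fin n) (Fin n) ℂ,
      S₂ * A = fromBlocks P₁₁ P₁₂ P₂₁ P₂₂ := ⟨_, _, _, _, (fromBlocks_toBlocks _).symm⟩
  obtain ⟨Q₁₁, Q₁₂, Q₂₁, Q₂₂, hQ⟩ : ∃ Q₁₁ Q₁₂ Q₂₁ Q₂₂ : Matrix (Fin n) (Fin n) ℂ,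
      S₁ * B = fromBlocks Q₁₁ Q₁₂ Q₂₁ Q₂₂ := ⟨_, _, _, _, (fromBlocks_toBlocks _).symm⟩
  rw [hP] at he he' hA
  rw [hQ] at he he' hB
  rw [fromBlocks_mul_eq_iff] at he he'
  set T := fromBlocks Q₂₁ Q₂₂ (-P₁₁) (-P₁₂) with hT
  -- Each row of `P` and `Q` is, up to sign, a row of `T` or of the right-hand side `X T`.
  have hPT : fromBlocks P₁₁ P₁₂ P₂₁ P₂₂ = fromBlocks 0 (-1) X₂₁ X₂₂ * T := by
    simp only [hT, fromBlocks_multiply, fromBlocks_inj] at he ⊢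
    exact ⟨by simp, by simp, he.2.2.1.symm, he.2.2.2.symm⟩
  have hQT : fromBlocks Q₁₁ Q₁₂ Q₂₁ Q₂₂ = fromBlocks (-X₁₁) (-X₁₂) 1 0 * T := by
    simp only [hT, fromBlocks_multiply, fromBlocks_inj] at he ⊢
    refine ⟨?_, ?_, by simp, by simp⟩
    · rw [Matrix.neg_mul, Matrix.neg_mul, ← neg_add, he.1, neg_neg]
    · rw [Matrix.neg_mul, Matrix.neg_mul, ← neg_add, he.2.1, neg_neg]
  have hleft : (C * (S₂' * fromBlocks 0 (-1) X₂₁ X₂₂) +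
      D * (S₁' * fromBlocks (-X₁₁) (-X₁₂) 1 0)) * T = 1 := by
    rw [Matrix.add_mul, Matrix.mul_assoc, Matrix.mul_assoc, Matrix.mul_assoc, Matrix.mul_assoc,
      ← hPT, ← hQT, hA, hB, hAB]
  have hright := mul_eq_one_comm.mp hleft
  have hXY : fromBlocks Y₁₁ Y₁₂ Y₂₁ Y₂₂ = fromBlocks X₁₁ X₁₂ X₂₁ X₂₂ := by
    rw [← Matrix.mul_one (fromBlocks Y₁₁ Y₁₂ Y₂₁ Y₂₂), ← hright, ← Matrix.mul_assoc, he', ← he,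
      Matrix.mul_assoc, hright, Matrix.mul_one]
  obtain ⟨rfl, rfl, rfl, rfl⟩ := fromBlocks_inj.mp hXY
  exact ⟨hM'.trans hM.symm, hL'.trans hL.symm⟩

end PairClass

/-! ### Regularity -/

lemma exists_ne_zero_isUnit_sub_smul_one {ι : Type*} [Fintype ι] [DecidableEq ι]
    (E : Matrix ι ι ℂ) : ∃ z : ℂ, z ≠ 0 ∧ IsUnit (E - z • (1 : Matrix ι ι ℂ)) := by
  obtain ⟨z, hz⟩ := Polynomial.exists_eval_ne_zero_of_natDegree_lt_card
    (Polynomial.X * E.charpoly) (mul_ne_zero Polynomial.X_ne_zero E.charpoly_monic.ne_zero)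
    ((Cardinal.natCast_lt_aleph0).trans_le (Cardinal.aleph0_le_mk ℂ))
  rw [Polynomial.eval_mul, Polynomial.eval_X, Matrix.eval_charpoly] at hz
  refine ⟨z, left_ne_zero_of_mul hz, ?_⟩
  rw [← IsUnit.neg_iff, neg_sub, Matrix.isUnit_iff_isUnit_det, Matrix.smul_one_eq_diagonal]
  exact (right_ne_zero_of_mul hz).isUnit

/-- A pair with right invertible block row `[M, L]` that satisfies the eigenvector relations is
regular. -/
lemma PreservesEigenvectorsAt.isRegularPair {n k l : ℕ}
    {U₁ : Matrix (Fin n ⊕ Fin n) (Fin k ⊕ Fin k) ℂ} {U₀ Uinf : Matrix (Fin n ⊕ Fin n) (Fin l) ℂ}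
    (hsize : k + l = n)
    (hU : (frame U₁ U₀ Uinf)ᴴ * symJ n * frame U₁ U₀ Uinf = symJSum k l)
    {Hhat : Matrix (Fin k ⊕ Fin k) (Fin k ⊕ Fin k) ℂ} {t : ℝ}
    {M L A B : Matrix (Fin n ⊕ Fin n) (Fin n ⊕ Fin n) ℂ}
    (h : PreservesEigenvectorsAt U₁ U₀ Uinf Hhat t M L) (hAB : M * A + L * B = 1) :
    IsRegularPair M L := by
  obtain ⟨h₀, hinf, h₁⟩ := h
  set E := NormedSpace.exp (t • Hhat)
  obtain ⟨V, hUV, -⟩ := exists_frame_inverse hsize hU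
  obtain ⟨z, hz, hE⟩ := exists_ne_zero_isUnit_sub_smul_one E
  obtain ⟨G, hG, -⟩ := isUnit_iff_exists.mp hE
  refine ⟨z, ?_⟩
  set R := M - z • L with hR
  have hRU : R * frame U₁ U₀ Uinf = fromCols (L * U₁ * (E - z • 1))
      (fromCols (-z • (L * U₀)) (M * Uinf)) := by
    rw [mul_frame, hR, Matrix.sub_mul, Matrix.sub_mul, Matrix.sub_mul, Matrix.smul_mul,
      Matrix.smul_mul, Matrix.smul_mul, h₀, hinf, h₁, Matrix.mul_sub, Matrix.mul_smul,
      Matrix.mul_one, zero_sub, smul_zero, sub_zero, neg_smul]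
  have hright (N : Matrix (Fin n ⊕ Fin n) (Fin n ⊕ Fin n) ℂ)
      (D : Matrix ((Fin k ⊕ Fin k) ⊕ (Fin l ⊕ Fin l)) ((Fin k ⊕ Fin k) ⊕ (Fin l ⊕ Fin l)) ℂ)
      (hN : R * frame U₁ U₀ Uinf * D = N * frame U₁ U₀ Uinf) :
      R * (frame U₁ U₀ Uinf * D * V) = N := by
    rw [← Matrix.mul_assoc, ← Matrix.mul_assoc, hN, Matrix.mul_assoc, hUV, Matrix.mul_one]
  -- `(M - z L) U = [L U₁ (E - z), -z L U₀, M U∞]`, `L U = [L U₁, L U₀, 0]`,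
  -- `M U = [L U₁ E, 0, M U∞]`: the factors below are read off column by column.
  have hL := hright L (blockSum k l G ((-z)⁻¹ • 1) 0) (by
    rw [hRU, fromCols_mul_blockSum, mul_frame, Matrix.mul_assoc _ _ G, hG, hinf]
    simp [smul_smul, hz])
  have hM := hright M (blockSum k l (G * E) 0 1) (by
    rw [hRU, fromCols_mul_blockSum, mul_frame, Matrix.mul_assoc _ _ (G * E),
      ← Matrix.mul_assoc _ G, hG, h₀, h₁]
    simp)
  have hone : R * (frame U₁ U₀ Uinf * blockSum k l (G * E) 0 1 * V * A +
      frame U₁ U₀ Uinf * blockSum k l G ((-z)⁻¹ • 1) 0 * V * B) = 1 := by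
    rw [Matrix.mul_add, ← Matrix.mul_assoc R _ A, ← Matrix.mul_assoc R _ B, hM, hL, hAB]
  exact Matrix.det_ne_zero_of_right_inverse hone

end SymplecticFlow

theorem theorem3p6 {n k l : ℕ}
    (S₁ S₂ : Matrix (Fin n ⊕ Fin n) (Fin n ⊕ Fin n) ℂ)
    (hS₁ : SymplecticFlow.IsSymplectic S₁) (hS₂ : SymplecticFlow.IsSymplectic S₂)
    (M₁ L₁ : Matrix (Fin n ⊕ Fin n) (Fin n ⊕ Fin n) ℂ)
    (hclass : (M₁, L₁) ∈ SymplecticFlow.pairClass S₁ S₂)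
    (hreg : SymplecticFlow.IsRegularPair M₁ L₁)
    (hsymp : SymplecticFlow.IsSymplecticPair M₁ L₁)
    (hind : ∃ ν ≤ 1, SymplecticFlow.HasIndexAtInfinity M₁ L₁ ν)
    (U₁ : Matrix (Fin n ⊕ Fin n) (Fin k ⊕ Fin k) ℂ)
    (U₀ Uinf : Matrix (Fin n ⊕ Fin n) (Fin l) ℂ)
    (Shat Hhat : Matrix (Fin k ⊕ Fin k) (Fin k ⊕ Fin k) ℂ)
    (hdata : SymplecticFlow.IsEigenData M₁ L₁ U₁ U₀ Uinf Shat Hhat)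
    (t : ℝ) (M L : Matrix (Fin n ⊕ Fin n) (Fin n ⊕ Fin n) ℂ) :
    (SymplecticFlow.IsSolutionAt S₁ S₂ U₁ U₀ Uinf Hhat t M L →
      SymplecticFlow.IsRegularPair M L ∧
      (∀ M' L' : Matrix (Fin n ⊕ Fin n) (Fin n ⊕ Fin n) ℂ,
        SymplecticFlow.IsSolutionAt S₁ S₂ U₁ U₀ Uinf Hhat t M' L' → M' = M ∧ L' = L) ∧
      SymplecticFlow.PreservesEigenvectorsAt U₁ U₀ Uinf Hhat t M L) ∧
    ((M, L) ∈ SymplecticFlow.pairClass S₁ S₂ →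
      SymplecticFlow.PreservesEigenvectorsAt U₁ U₀ Uinf Hhat t M L →
      SymplecticFlow.IsSolutionAt S₁ S₂ U₁ U₀ Uinf Hhat t M L) := by
  have hsize := hdata.size
  have hU := hdata.frame_symJ
  have hiff := SymplecticFlow.system_iff_preservesEigenvectorsAt hsize hU Hhat t
  constructor
  · rintro ⟨hsys, hML⟩
    have hpres := (hiff M L).mp hsys
    refine ⟨?_, ?_, hpres⟩
    · obtain ⟨A, B, hAB⟩ := SymplecticFlow.exists_mul_add_mul_eq_one hS₁ hS₂ hML
      exact hpres.isRegularPair hsize hU hAB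
    · rintro M' L' ⟨hsys', hML'⟩
      obtain ⟨B, C, hBC⟩ :=
        SymplecticFlow.exists_mul_projZero_add_mul_projInf_eq_one hsize hU Hhat t
      rw [Matrix.mul_assoc] at hsys hsys'
      exact SymplecticFlow.pairClass_unique hS₁ hS₂ hBC hML hML' hsys hsys'
  · exact fun hML hpres => ⟨(hiff M L).mpr hpres, hML⟩
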